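/- Let $\mathbb R^n,\mathbb R^m,\mathbb R^\ell$ carry their Euclidean structure, and let $T_1\colon\mathbb R^n\rightrightarrows\mathbb R^m$ and $T_2\colon\mathbb R^m\rightrightarrows\mathbb R^\ell$ be set-valued mappings with closed graphs. Put $$T(x):=\bigcup_{y\in T_1(x)}T_2(y),\qquad \Theta(x,z):=\{y\in T_1(x)\mid z\in T_2(y)\},$$ so that $\operatorname{gph}T=\operatorname{dom}\Theta$. **Conventions.** For a set-valued mapping $\Upsilon$, $\limsup_{u\to\bar u}\Upsilon(u)$ is the sequential outer Painlevé–Kuratowski limit, i.e. the set of all limits of convergent sequences $v_k\in\Upsilon(u_k)$ with $u_k\to\bar u$, and $\Upsilon^{-1}(v):=\{u\mid v\in\Upsilon(u)\}$. For a set $A$ and $\bar u\in A$, let $\mathcal T_A(\bar u):=\limsup_{t\searrow0}(A-\bar u)/t$, $\widehat{\mathcal N}_A(\bar u):=\{v\mid v^\top d\le 0\ \forall d\in\mathcal T_A(\bar u)\}$ and $\mathcal N_A(\bar u):=\limsup_{u\to\bar u,\,u\in A}\widehat{\mathcal N}_A(u)$; all three sets are empty if $\bar u\notin A$. The limiting coderivative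 is $D^*\Upsilon(x,y)(y^*):=\{x^*\mid(x^*,-y^*)\in\mathcal N_{\operatorname{gph}\Upsilon}(x,y)\}$ (empty if $(x,y)\notin\operatorname{gph}\Upsilon$). For sets, $A-B:=\{a-b\mid a\in A,\,b\in B\}$. The mapping $\Upsilon$ is *inner semicontinuous* at $(\bar u,\bar v)\in\operatorname{gph}\Upsilon$ if for each sequence $u_k\to\bar u$ with $u_k\in\operatorname{dom}\Upsilon$ there is a sequence $v_k\to\bar v$ with $v_k\in\Upsilon(u_k)$ for all large $k$; it is *inner semicompact* at $\bar u$ if for each sequence $u_k\to\bar u$ with $u_k\in\operatorname{dom}\Upsilon$ there is a bounded sequence $v_k$ with $v_k\in\Upsilon(u_k)$ for all large $k$. **Theorem.** Fix $(\bar x,\bar z)\in\operatorname{gph}T$. For $\bar y\in\Theta(\bar x,\bar z)$, $\bar x^*\in\mathbb R^n$ and $\bar z^*\in\mathbb R^\ell$, consider the qualification condition $$\limsup_{\substack{(x,y^1)\to(\bar x,\bar y)\\(y^2,z)\to(\bar y,\bar z)\\(x^*,z^*)\to(\bar x^*,\bar z^*)}}\Bigl(D^*T_2(y^2,z)(z^*)-\bigl(D^*T_1(x,y^1)\bigr)^{-1}(x^*)\Bigr)\subset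 D^*T_2(\bar y,\bar z)(\bar z^*)-\bigl(D^*T_1(\bar x,\bar y)\bigr)^{-1}(\bar x^*).\tag{Q}$$ (a) Let $\bar y\in\Theta(\bar x,\bar z)$ be such that $\Theta$ is inner semicontinuous at $((\bar x,\bar z),\bar y)$ and (Q) holds for this $\bar y$ and all $\bar x^*\in\mathbb R^n$, $\bar z^*\in\mathbb R^\ell$. Then, for each $z^*\in\mathbb R^\ell$, $$D^*T(\bar x,\bar z)(z^*)\subset\bigcup_{y^*\in D^*T_2(\bar y,\bar z)(z^*)}D^*T_1(\bar x,\bar y)(y^*).$$ (b) Let $\Theta$ be inner semicompact at $(\bar x,\bar z)$ and let (Q) hold for each $\bar y\in\Theta(\bar x,\bar z)$ and all $\bar x^*\in\mathbb R^n$, $\bar z^*\in\mathbb R^\ell$. Then, for each $z^*\in\mathbb R^\ell$, $$D^*T(\bar x,\bar z)(z^*)\subset\bigcup_{\bar y\in\Theta(\bar x,\bar z)}\ \bigcup_{y^*\in D^*T_2(\bar y,\bar z)(z^*)}D^*T_1(\bar x,\bar y)(y^*).$$ -/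

import Mathlib

open Filter Topology
open scoped Pointwise

namespace VarAnalysis

section General

variable {E F G : Type*}

/-- Sequential outer (Painlevé–Kuratowski) limit of the sets `Υ a` as `a` tends to the filter `l`. -/
def outerLimit [TopologicalSpace F] (Υ : E → Set F) (l : Filter E) : Set F :=
  {y | ∃ (a : ℕ → E) (v : ℕ → F),
    Tendsto a atTop l ∧ Tendsto v atTop (𝓝 y) ∧ ∀ k, v k ∈ Υ (a k)}

/-- The inverse of a set-valued mapping. -/
def inverse (Υ : E → Set F) : F → Set E := fun y => {x | y ∈ Υ x}

/-- The domain of a set-valued mapping. -/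
def dom (Υ : E → Set F) : Set E := {x | (Υ x).Nonempty}

/-- The composition `T₂ ∘ T₁` of set-valued mappings. -/
def comp (T₂ : F → Set G) (T₁ : E → Set F) : E → Set G := fun x => ⋃ y ∈ T₁ x, T₂ y

/-- The intermediate mapping `Θ(x, z) = {y ∈ T₁(x) | z ∈ T₂(y)}`. -/
def intermediate (T₁ : E → Set F) (T₂ : F → Set G) : E × G → Set F :=
  fun p => {y | y ∈ T₁ p.1 ∧ p.2 ∈ T₂ y}

/-- Inner semicontinuity at `(x̄, ȳ)`: for all sequences in the domain that tend to `x̄`, there are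
image points (for all large `k`) that tend to `ȳ`. -/
def InnerSemicontinuousAt [TopologicalSpace E] [TopologicalSpace F]
    (Υ : E → Set F) (xb : E) (yb : F) : Prop :=
  ∀ x : ℕ → E, Tendsto x atTop (𝓝 xb) → (∀ k, x k ∈ dom Υ) →
    ∃ y : ℕ → F, Tendsto y atTop (𝓝 yb) ∧ ∀ᶠ k in atTop, y k ∈ Υ (x k)

/-- Inner semicompactness at `x̄`: for all sequences in the domain that tend to `x̄`, there is a
bounded sequence of image points (for all large `k`). -/
def InnerSemicompactAt [TopologicalSpace E] [Bornology F]
    (Υ : E → Set F) (xb : E) : Prop :=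
  ∀ x : ℕ → E, Tendsto x atTop (𝓝 xb) → (∀ k, x k ∈ dom Υ) →
    ∃ y : ℕ → F, Bornology.IsBounded (Set.range y) ∧ ∀ᶠ k in atTop, y k ∈ Υ (x k)

end General

section Normals

variable {E : Type*} [NormedAddCommGroup E] [InnerProductSpace ℝ E]

/-- The polar cone. -/
def polarCone (A : Set E) : Set E := {v | ∀ d ∈ A, inner ℝ d v ≤ 0}

/-- The tangent (Bouligand) cone, the outer limit of `(A - x) / t` as `t ↘ 0`;
empty if `x ∉ A`. -/
def tangentCone (A : Set E) (x : E) : Set E :=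
  {d | x ∈ A ∧ d ∈ outerLimit (fun t : ℝ => t⁻¹ • (A - {x})) (𝓝[>] 0)}

/-- The regular (Fréchet) normal cone; empty if `x ∉ A`. -/
def regularNormalCone (A : Set E) (x : E) : Set E :=
  {v | x ∈ A ∧ v ∈ polarCone (tangentCone A x)}

/-- The limiting (Mordukhovich) normal cone; empty if `x ∉ A`. -/
def limitingNormalCone (A : Set E) (x : E) : Set E :=
  {v | x ∈ A ∧ v ∈ outerLimit (regularNormalCone A) (𝓝[A] x)}

end Normals

section Coderivative

variable {E F G : Type*}
  [NormedAddCommGroup E] [InnerProductSpace ℝ E]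
  [NormedAddCommGroup F] [InnerProductSpace ℝ F]
  [NormedAddCommGroup G] [InnerProductSpace ℝ G]

/-- The graph of a set-valued mapping, in the product space with its Euclidean structure. -/
def gph (Υ : E → Set F) : Set (WithLp 2 (E × F)) := {p | p.snd ∈ Υ p.fst}

/-- The limiting coderivative `D*Υ(x, y)`; it has empty values if `(x, y) ∉ gph Υ`. -/
def coderivative (Υ : E → Set F) (x : E) (y : F) : F → Set E :=
  fun ys => {xs | WithLp.toLp 2 (xs, -ys) ∈ limitingNormalCone (gph Υ) (WithLp.toLp 2 (x, y))}

/-- The asymptotic qualification condition of the chain rule at `(x̄, ȳ, z̄)`: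
for all `x̄*`, `z̄*`, the outer limit of
`D*T₂(y², z)(z*) - (D*T₁(x, y¹))⁻¹(x*)` as `(x, y¹) → (x̄, ȳ)`, `(y², z) → (ȳ, z̄)`,
`(x*, z*) → (x̄*, z̄*)` is contained in `D*T₂(ȳ, z̄)(z̄*) - (D*T₁(x̄, ȳ))⁻¹(x̄*)`,
where `A - B` is the set of all differences. -/
def ChainRuleCQ (T₁ : E → Set F) (T₂ : F → Set G) (xb : E) (yb : F) (zb : G) : Prop :=
  ∀ (xsb : E) (zsb : G),
    outerLimit
        (fun p : (E × F) × (F × G) × (E × G) =>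
          match p with
          | ((x, y₁), (y₂, z), (xs, zs)) =>
            coderivative T₂ y₂ z zs - inverse (coderivative T₁ x y₁) xs)
        (𝓝 ((xb, yb), (yb, zb), (xsb, zsb)))
      ⊆ coderivative T₂ yb zb zsb - inverse (coderivative T₁ xb yb) xsb

end Coderivative

end VarAnalysis

namespace VarAnalysis

/-! ### Regular normals: Fréchet and proximal inequalities, and a penalty principle. -/

section Normals

variable {E : Type*} [NormedAddCommGroup E] [InnerProductSpace ℝ E]

/-! A coderivative element of the composition is a limit of regular normals at nearby graph points.
Each of these makes its point nearly optimal for a linear function over pairs in `gph T₁ × gph T₂`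
sharing the same `y`. Doubling `y` into `y₁, y₂` and penalizing `‖y₁ - y₂‖ ^ 2` decouples the
graphs; the optimality conditions in each pair give `fuzzy_chain_rule`, with dual variables `ys₁,
ys₂` that may be huge but nearly agree. Thus `ys₂ - ys₁ → 0`, so (Q) puts `0` in the limiting
difference set: a common `ys` exists, without any bound on the multipliers (`mem_chain_of_tendsto`).
Inner semicontinuity or semicompactness only supplies the convergent intermediate points. -/

theorem inner_le_of_mem_regularNormalCone [FiniteDimensional ℝ E] {A : Set E} {x v : E}
    (hv : v ∈ regularNormalCone A x) {ε : ℝ} (hε : 0 < ε) :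
    ∃ δ > 0, ∀ u ∈ A, ‖u - x‖ < δ → inner ℝ (u - x) v ≤ ε * ‖u - x‖ := by
  have := FiniteDimensional.proper_real E
  by_contra! hcon
  choose u huA hux hlt using fun k : ℕ => hcon (1 / ((k : ℝ) + 1)) (by positivity)
  have hpos (k : ℕ) : 0 < ‖u k - x‖ := by
    refine norm_pos_iff.2 fun h0 => ?_
    have := hlt k
    simp [h0] at this
  have htend : Tendsto (fun k => ‖u k - x‖) atTop (𝓝 0) :=
    squeeze_zero (fun _ => norm_nonneg _) (fun k => (hux k).le)
      tendsto_one_div_add_atTop_nhds_zero_nat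
  -- Finite dimension enters here: normalized violating directions subconverge to a tangent
  -- direction, contradicting polarity.
  obtain ⟨d, -, ψ, hψ, hd⟩ := (isCompact_sphere (0 : E) 1).tendsto_subseq
    (x := fun k => ‖u k - x‖⁻¹ • (u k - x))
    (fun k => by simp [norm_smul, (hpos k).ne'])
  have hdT : d ∈ tangentCone A x := by
    refine ⟨hv.1, fun k => ‖u (ψ k) - x‖, _, ?_, hd, fun k => ?_⟩
    · exact tendsto_nhdsWithin_iff.2
        ⟨htend.comp hψ.tendsto_atTop, Eventually.of_forall fun k => hpos _⟩
    · exact Set.smul_mem_smul_set (Set.sub_mem_sub (huA _) rfl)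
  have hle : ε ≤ inner ℝ d v := by
    refine ge_of_tendsto (hd.inner (tendsto_const_nhds (x := v)))
      (Eventually.of_forall fun k => ?_)
    simp only [Function.comp, real_inner_smul_left]
    rw [inv_mul_eq_div, le_div_iff₀ (hpos _)]
    exact (hlt _).le
  exact (hv.2 d hdT).not_gt (hε.trans_le hle)

/-- Proximal normals are regular normals. -/
theorem mem_regularNormalCone_of_inner_le_sq {A : Set E} {x v : E} (hx : x ∈ A) (M : ℝ)
    (h : ∀ᶠ u in 𝓝[A] x, inner ℝ (u - x) v ≤ M * ‖u - x‖ ^ 2) :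
    v ∈ regularNormalCone A x := by
  refine ⟨hx, ?_⟩
  rintro d ⟨-, t, w, ht, hw, hmem⟩
  obtain ⟨ht0, htpos⟩ := tendsto_nhdsWithin_iff.1 ht
  have key : ∀ᶠ k in atTop, x + t k • w k ∈ A := by
    filter_upwards [htpos] with k hk
    obtain ⟨_, ⟨a, ha, x', hx', rfl⟩, hwk⟩ := hmem k
    rw [Set.mem_singleton_iff.1 hx'] at hwk
    have : x + t k • w k = a := by
      rw [← hwk]
      simp [smul_smul, mul_inv_cancel₀ (Set.mem_Ioi.1 hk).ne']
    rwa [this]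
  have hlim : Tendsto (fun k => x + t k • w k) atTop (𝓝[A] x) := by
    refine tendsto_nhdsWithin_iff.2 ⟨?_, key⟩
    simpa using tendsto_const_nhds (x := x).add (ht0.smul hw)
  have hR : Tendsto (fun k => M * (t k * ‖w k‖ ^ 2)) atTop (𝓝 0) := by
    simpa using (ht0.mul (hw.norm.pow 2)).const_mul M
  refine le_of_tendsto_of_tendsto (hw.inner (tendsto_const_nhds (x := v))) hR ?_
  filter_upwards [hlim.eventually h, htpos] with k hk hk0
  have hk0 : 0 < t k := hk0
  simp only [add_sub_cancel_left, real_inner_smul_left, norm_smul, Real.norm_eq_abs,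
    abs_of_pos hk0, mul_pow] at hk
  have : t k * inner ℝ (w k) v ≤ t k * (M * (t k * ‖w k‖ ^ 2)) := by linarith
  exact le_of_mul_le_mul_left this hk0

theorem regularNormalCone_subset_limitingNormalCone (A : Set E) (x : E) :
    regularNormalCone A x ⊆ limitingNormalCone A x := fun v hv =>
  ⟨hv.1, fun _ => x, fun _ => v,
    tendsto_nhdsWithin_iff.2 ⟨tendsto_const_nhds, Eventually.of_forall fun _ => hv.1⟩,
    tendsto_const_nhds, fun _ => hv⟩

end Normals

/-- Penalty principle: if every feasible point with nonpositive value lies in the open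
set `U`, then for a large penalty parameter the penalized problem has a minimizer in `U`. -/
theorem exists_penalized_minimizer {X : Type*} [TopologicalSpace X] [FirstCountableTopology X]
    {K U : Set X} (hK : IsCompact K) (hU : IsOpen U) {f g : X → ℝ} (hf : Continuous f)
    (hg : Continuous g) (hg0 : ∀ u, 0 ≤ g u) {u₀ : X} (hu₀ : u₀ ∈ K) (hfu₀ : f u₀ = 0)
    (hgu₀ : g u₀ = 0) (hKU : ∀ u ∈ K, g u = 0 → f u ≤ 0 → u ∈ U) :
    ∃ k : ℝ, 0 ≤ k ∧ ∃ w ∈ K, w ∈ U ∧ ∀ u ∈ K, f w + k * g w ≤ f u + k * g u := by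
  choose w hwK hw using fun k : ℕ =>
    hK.exists_isMinOn ⟨u₀, hu₀⟩ (f := fun u => f u + (k : ℝ) * g u) (by fun_prop)
  obtain ⟨wl, hwl, ψ, hψ, hlim⟩ := hK.tendsto_subseq hwK
  have hle (k : ℕ) : f (w k) + (k : ℝ) * g (w k) ≤ 0 := by
    simpa [hfu₀, hgu₀] using isMinOn_iff.1 (hw k) u₀ hu₀
  have hflim : Tendsto (fun k => f (w (ψ k))) atTop (𝓝 (f wl)) :=
    (hf.tendsto wl).comp hlim
  have hglim : Tendsto (fun k => g (w (ψ k))) atTop (𝓝 (g wl)) :=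
    (hg.tendsto wl).comp hlim
  have hfl : f wl ≤ 0 := le_of_tendsto hflim <| Eventually.of_forall fun k => by
    have := mul_nonneg (Nat.cast_nonneg (α := ℝ) (ψ k)) (hg0 (w (ψ k)))
    linarith [hle (ψ k)]
  have hgl : g wl = 0 := by
    -- Comparison with `u₀` gives `g ≤ -f / k` at the minimizers, and `f` stays bounded along the
    -- convergent subsequence.
    refine le_antisymm ?_ (hg0 wl)
    have hinv : Tendsto (fun k => ((ψ k : ℕ) : ℝ)⁻¹) atTop (𝓝 0) :=
      tendsto_inv_atTop_nhds_zero_nat.comp hψ.tendsto_atTop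
    have hz : Tendsto (fun k => ((ψ k : ℕ) : ℝ)⁻¹ * -f (w (ψ k))) atTop (𝓝 0) := by
      simpa using hinv.mul hflim.neg
    refine le_of_tendsto_of_tendsto hglim hz ?_
    filter_upwards [hψ.tendsto_atTop.eventually_gt_atTop 0] with k hk
    have hk' : (0 : ℝ) < ψ k := Nat.cast_pos.2 hk
    rw [inv_mul_eq_div, le_div_iff₀ hk']
    linarith [hle (ψ k)]
  obtain ⟨k, hk⟩ := (hlim.eventually (hU.mem_nhds (hKU wl hwl hgl hfl))).exists
  exact ⟨ψ k, Nat.cast_nonneg _, w (ψ k), hwK _, hk, fun u hu => isMinOn_iff.1 (hw (ψ k)) u hu⟩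

/-! ### Coderivatives and the fuzzy chain rule. -/

section Coderivative

variable {E F G : Type*}
  [NormedAddCommGroup E] [InnerProductSpace ℝ E]
  [NormedAddCommGroup F] [InnerProductSpace ℝ F]
  [NormedAddCommGroup G] [InnerProductSpace ℝ G]

/-- Exact Taylor expansion at `b`: it turns minimality of a linear-plus-quadratic function into a
proximal normal inequality, with the gradient as dual vector. -/
theorem mul_norm_sub_sq_eq (c : ℝ) (a b p : E) :
    c * ‖a - p‖ ^ 2 =
      c * ‖b - p‖ ^ 2 + inner ℝ (a - b) ((2 * c) • (b - p)) + c * ‖a - b‖ ^ 2 := by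
  have h : a - p = (a - b) + (b - p) := by abel
  rw [h, norm_add_sq_real, real_inner_smul_right]
  ring

theorem inner_sub_eq_add (a b p v : E) :
    inner ℝ (a - p) v = inner ℝ (a - b) v + inner ℝ (b - p) v := by
  rw [← inner_add_left, sub_add_sub_cancel]

theorem mem_coderivative_of_inner_le_sq {Υ : E → Set F} {x xs : E} {y ys : F} (hy : y ∈ Υ x)
    (M : ℝ)
    (h : ∀ᶠ u : E × F in 𝓝 (x, y), u.2 ∈ Υ u.1 →
      inner ℝ (u.1 - x) xs + inner ℝ (u.2 - y) (-ys) ≤ M * (‖u.1 - x‖ ^ 2 + ‖u.2 - y‖ ^ 2)) :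
    xs ∈ coderivative Υ x y ys := by
  refine regularNormalCone_subset_limitingNormalCone _ _
    (mem_regularNormalCone_of_inner_le_sq hy M ?_)
  have hcont : Tendsto (WithLp.ofLp : WithLp 2 (E × F) → E × F) (𝓝 (WithLp.toLp 2 (x, y)))
      (𝓝 (x, y)) :=
    (WithLp.prod_continuous_ofLp 2 E F).tendsto _
  rw [eventually_nhdsWithin_iff]
  filter_upwards [hcont.eventually h] with u hu hmem
  rw [WithLp.prod_inner_apply, WithLp.prod_norm_sq_eq_of_L2]
  exact hu hmem

/-- Fuzzy chain rule: regular normals to the graph of a composition are approximated by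
coderivatives of the components at nearby points, with nearly matching dual variables. -/
theorem fuzzy_chain_rule [FiniteDimensional ℝ E] [FiniteDimensional ℝ F]
    [FiniteDimensional ℝ G]
    {T₁ : E → Set F} {T₂ : F → Set G} (hT₁ : IsClosed (gph T₁)) (hT₂ : IsClosed (gph T₂))
    {xb : E} {yb : F} {zb : G} (hyb : yb ∈ intermediate T₁ T₂ (xb, zb)) {xs : E} {zs : G}
    (hN : WithLp.toLp 2 (xs, -zs) ∈
      regularNormalCone (gph (comp T₂ T₁)) (WithLp.toLp 2 (xb, zb)))
    {ε : ℝ} (hε : 0 < ε) :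
    ∃ (x xs' : E) (y₁ y₂ ys₁ ys₂ : F) (z zs' : G),
      ‖x - xb‖ ≤ ε ∧ ‖y₁ - yb‖ ≤ ε ∧ ‖y₂ - yb‖ ≤ ε ∧ ‖z - zb‖ ≤ ε ∧ ‖xs' - xs‖ ≤ ε ∧
      ‖zs' - zs‖ ≤ ε ∧ ‖ys₂ - ys₁‖ ≤ ε ∧
      xs' ∈ coderivative T₁ x y₁ ys₁ ∧ ys₂ ∈ coderivative T₂ y₂ z zs' := by
  have := FiniteDimensional.proper_real E
  have := FiniteDimensional.proper_real F
  have := FiniteDimensional.proper_real G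
  obtain ⟨δ', hδ', hδN⟩ := inner_le_of_mem_regularNormalCone hN (ε := ε / 8) (by positivity)
  -- `δ < δ'` is strict because points of `K` only satisfy a bound `≤ δ`, while `hδN` needs `<`.
  obtain ⟨δ, hδ, hδδ', hδε⟩ : ∃ δ > 0, δ < δ' ∧ δ ≤ ε :=
    ⟨min (δ' / 2) ε, lt_min (half_pos hδ') hε, (min_le_left _ _).trans_lt (half_lt_self hδ'),
      min_le_right _ _⟩
  -- With `c * δ = ε / 4`, the quadratic term beats the error `ε / 8 * s` on the sphere `Q = δ ^ 2`,
  -- yet each of its gradients has norm at most `ε / 2`.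
  obtain ⟨c, hc⟩ : ∃ c, c = ε / 8 * 2 / δ := ⟨_, rfl⟩
  have hcδ : c * δ = ε / 4 := by rw [hc]; field_simp; ring
  have hc0 : 0 < c := by rw [hc]; positivity
  let Q : (E × F) × (F × G) → ℝ := fun u =>
    ‖u.1.1 - xb‖ ^ 2 + ‖u.1.2 - yb‖ ^ 2 + ‖u.2.1 - yb‖ ^ 2 + ‖u.2.2 - zb‖ ^ 2
  have hQ : Continuous Q := by fun_prop
  let f : (E × F) × (F × G) → ℝ := fun u =>
    inner ℝ (u.2.2 - zb) zs - inner ℝ (u.1.1 - xb) xs + c * Q u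
  have hf : Continuous f := by fun_prop
  let g : (E × F) × (F × G) → ℝ := fun u => ‖u.1.2 - u.2.1‖ ^ 2
  have hg : Continuous g := by fun_prop
  let U : Set ((E × F) × (F × G)) := {u | Q u < δ ^ 2}
  have hU : IsOpen U := isOpen_lt hQ continuous_const
  let K : Set ((E × F) × (F × G)) :=
    {u | u.1.2 ∈ T₁ u.1.1} ∩ {u | u.2.2 ∈ T₂ u.2.1} ∩ {u | Q u ≤ δ ^ 2}
  have hle {u : (E × F) × (F × G)} (hu : Q u ≤ δ ^ 2) :
      ‖u.1.1 - xb‖ ≤ δ ∧ ‖u.1.2 - yb‖ ≤ δ ∧ ‖u.2.1 - yb‖ ≤ δ ∧ ‖u.2.2 - zb‖ ≤ δ := by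
    have h₁ := sq_nonneg ‖u.1.1 - xb‖
    have h₂ := sq_nonneg ‖u.1.2 - yb‖
    have h₃ := sq_nonneg ‖u.2.1 - yb‖
    have h₄ := sq_nonneg ‖u.2.2 - zb‖
    have hu' : ‖u.1.1 - xb‖ ^ 2 + ‖u.1.2 - yb‖ ^ 2 + ‖u.2.1 - yb‖ ^ 2 + ‖u.2.2 - zb‖ ^ 2
      ≤ δ ^ 2 := hu
    refine ⟨?_, ?_, ?_, ?_⟩ <;> exact le_of_sq_le_sq (by linarith) hδ.le
  have hK : IsCompact K := by
    have hclosed : IsClosed K :=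
      (((hT₁.preimage (WithLp.prod_continuous_toLp 2 E F)).preimage continuous_fst).inter
        ((hT₂.preimage (WithLp.prod_continuous_toLp 2 F G)).preimage continuous_snd)).inter
        (isClosed_le hQ continuous_const)
    refine (isCompact_closedBall ((xb, yb), (yb, zb)) δ).of_isClosed_subset hclosed ?_
    rintro u ⟨-, hu⟩
    obtain ⟨h₁, h₂, h₃, h₄⟩ := hle hu
    rw [mem_closedBall_iff_norm]
    exact max_le (max_le h₁ h₂) (max_le h₃ h₄)
  obtain ⟨k, hk, ⟨⟨x, y₁⟩, ⟨y₂, z⟩⟩, ⟨⟨hy₁, hz⟩, -⟩, hwU, hmin⟩ :=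
    exists_penalized_minimizer hK hU hf hg (fun u => sq_nonneg _)
      (u₀ := ((xb, yb), (yb, zb)))
      (by simp only [K, Q]; exact ⟨⟨hyb.1, hyb.2⟩, by simp; positivity⟩)
      (by simp [f, Q]) (by simp [g]) (by
        rintro ⟨⟨x, y⟩, ⟨y', z⟩⟩ ⟨⟨hy, hz⟩, hQle⟩ hg0 hf0
        obtain rfl : y = y' := by simpa [g, sub_eq_zero] using hg0
        change Q ((x, y), (y, z)) < δ ^ 2
        have hs2 : ‖WithLp.toLp 2 (x, z) - WithLp.toLp 2 (xb, zb)‖ ^ 2 =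
            ‖x - xb‖ ^ 2 + ‖z - zb‖ ^ 2 := WithLp.prod_norm_sq_eq_of_L2 _
        have hinner : inner ℝ (WithLp.toLp 2 (x, z) - WithLp.toLp 2 (xb, zb))
            (WithLp.toLp 2 (xs, -zs)) = inner ℝ (x - xb) xs + inner ℝ (z - zb) (-zs) :=
          WithLp.prod_inner_apply _ _
        rw [inner_neg_right] at hinner
        -- Once the copies of `y` coincide, `(x, z)` lies on the graph of the composition, so the
        -- linear part of `f` is at least `-(ε / 8) * s`.
        have hN' := hδN (WithLp.toLp 2 (x, z)) (Set.mem_biUnion hy hz)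
        rw [hinner] at hN'
        generalize ‖WithLp.toLp 2 (x, z) - WithLp.toLp 2 (xb, zb)‖ = s at hs2 hN'
        have hQeq : Q ((x, y), (y, z)) = s ^ 2 + 2 * ‖y - yb‖ ^ 2 := by
          simp only [Q]; rw [hs2]; ring
        have hsδ : s ≤ δ := le_of_sq_le_sq (by
          have : Q ((x, y), (y, z)) ≤ δ ^ 2 := hQle
          have := sq_nonneg ‖y - yb‖
          linarith) hδ.le
        have hcQ : c * Q ((x, y), (y, z)) ≤ ε / 8 * s := by
          have := hN' (hsδ.trans_lt hδδ')
          simp only [f] at hf0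
          linarith
        have hcQ' : c * Q ((x, y), (y, z)) < c * δ ^ 2 := by
          have : ε / 8 * s ≤ ε / 8 * δ := by gcongr
          have h' : 0 < ε / 8 * δ := by positivity
          have : c * δ ^ 2 = ε / 4 * δ := by rw [← hcδ]; ring
          linarith
        exact lt_of_mul_lt_mul_left hcQ' hc0.le)
  have hwU : Q ((x, y₁), (y₂, z)) < δ ^ 2 := hwU
  obtain ⟨hnx, hny₁, hny₂, hnz⟩ := hle hwU.le
  have hsmul {t : ℝ} (ht : t ≤ δ) : ‖2 * c‖ * t ≤ ε / 2 := by
    rw [Real.norm_of_nonneg (by positivity)]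
    calc 2 * c * t ≤ 2 * c * δ := by gcongr
      _ = ε / 2 := by linarith
  -- The dual vectors are read off the partial gradients of `f + k * g` at the minimizer.
  refine ⟨x, xs - (2 * c) • (x - xb), y₁, y₂, (2 * c) • (y₁ - yb) + (2 * k) • (y₁ - y₂),
    -((2 * c) • (y₂ - yb) + (2 * k) • (y₂ - y₁)), z, zs + (2 * c) • (z - zb),
    hnx.trans hδε, hny₁.trans hδε, hny₂.trans hδε, hnz.trans hδε, ?_, ?_, ?_, ?_, ?_⟩
  · rw [sub_sub_cancel_left, norm_neg, norm_smul]
    linarith [hsmul hnx]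
  · rw [add_sub_cancel_left, norm_smul]
    linarith [hsmul hnz]
  -- The uncontrolled terms in `k` cancel; two gradients of norm at most `ε / 2` remain.
  · have : -((2 * c) • (y₂ - yb) + (2 * k) • (y₂ - y₁)) -
        ((2 * c) • (y₁ - yb) + (2 * k) • (y₁ - y₂)) =
        -((2 * c) • (y₂ - yb) + (2 * c) • (y₁ - yb)) := by module
    rw [this, norm_neg]
    refine (norm_add_le _ _).trans ?_
    rw [norm_smul, norm_smul]
    linarith [hsmul hny₁, hsmul hny₂]
  · refine mem_coderivative_of_inner_le_sq hy₁ (c + k) ?_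
    -- The constraint on `Q` is inactive at the minimizer, so all nearby graph points compete while
    -- the other pair is frozen.
    have hev : ∀ᶠ u : E × F in 𝓝 (x, y₁), Q (u, (y₂, z)) < δ ^ 2 :=
      (hQ.comp (by fun_prop : Continuous fun u : E × F => (u, (y₂, z)))).continuousAt.eventually_lt
        continuousAt_const hwU
    filter_upwards [hev] with u hu hmem
    have h := hmin (u, (y₂, z)) ⟨⟨hmem, hz⟩, hu.le⟩
    simp only [f, g, Q, mul_add] at h
    rw [mul_norm_sub_sq_eq c u.1 x xb, mul_norm_sub_sq_eq c u.2 y₁ yb,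
      mul_norm_sub_sq_eq k u.2 y₁ y₂, inner_sub_eq_add u.1 x xb] at h
    simp only [inner_sub_right (𝕜 := ℝ) (u.1 - x) xs, inner_neg_right, inner_add_right]
    -- `g` has no curvature in this component, but the constant `c + k` is used for both.
    have := mul_nonneg hk (sq_nonneg ‖u.1 - x‖)
    linarith
  · refine mem_coderivative_of_inner_le_sq hz (c + k) ?_
    have hev : ∀ᶠ u : F × G in 𝓝 (y₂, z), Q ((x, y₁), u) < δ ^ 2 :=
      (hQ.comp (by fun_prop : Continuous fun u : F × G => ((x, y₁), u))).continuousAt.eventually_lt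
        continuousAt_const hwU
    filter_upwards [hev] with u hu hmem
    have h := hmin ((x, y₁), u) ⟨⟨hy₁, hmem⟩, hu.le⟩
    simp only [f, g, Q, mul_add, norm_sub_rev y₁] at h
    rw [mul_norm_sub_sq_eq c u.2 z zb, mul_norm_sub_sq_eq c u.1 y₂ yb,
      mul_norm_sub_sq_eq k u.1 y₂ y₁, inner_sub_eq_add u.2 z zb] at h
    simp only [inner_neg_right, inner_add_right]
    have := mul_nonneg hk (sq_nonneg ‖u.2 - z‖)
    linarith

theorem tendsto_of_norm_sub_le {X : Type*} [NormedAddCommGroup X] {a b : ℕ → X} {l : X} (hb : Tendsto b atTop (𝓝 l))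
    (hab : ∀ k, ‖a k - b k‖ ≤ 1 / ((k : ℝ) + 1)) : Tendsto a atTop (𝓝 l) := by
  have h : Tendsto (fun k => a k - b k) atTop (𝓝 0) :=
    squeeze_zero_norm hab tendsto_one_div_add_atTop_nhds_zero_nat
  simpa using h.add hb

/-- Chain rule along a convergent sequence of intermediate points. -/
theorem mem_chain_of_tendsto [FiniteDimensional ℝ E] [FiniteDimensional ℝ F]
    [FiniteDimensional ℝ G] {T₁ : E → Set F} {T₂ : F → Set G}
    (hT₁ : IsClosed (gph T₁)) (hT₂ : IsClosed (gph T₂)) {xb xs : E} {yb : F} {zb zs : G}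
    (hCQ : ChainRuleCQ T₁ T₂ xb yb zb) {p q : ℕ → WithLp 2 (E × G)} {y : ℕ → F}
    (hp : Tendsto p atTop (𝓝 (WithLp.toLp 2 (xb, zb))))
    (hq : Tendsto q atTop (𝓝 (WithLp.toLp 2 (xs, -zs))))
    (hy : Tendsto y atTop (𝓝 yb))
    (hN : ∀ k, q k ∈ regularNormalCone (gph (comp T₂ T₁)) (p k))
    (hyΘ : ∀ k, y k ∈ intermediate T₁ T₂ ((p k).fst, (p k).snd)) :
    xs ∈ ⋃ ys ∈ coderivative T₂ yb zb zs, coderivative T₁ xb yb ys := by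
  have hN' (k : ℕ) : WithLp.toLp 2 ((q k).fst, -(-(q k).snd)) ∈
      regularNormalCone (gph (comp T₂ T₁)) (WithLp.toLp 2 ((p k).fst, (p k).snd)) := by
    rw [neg_neg]; exact hN k
  choose x xs' y₁ y₂ ys₁ ys₂ z zs' hx hy₁ hy₂ hz hxs hzs hys h₁ h₂ using fun k : ℕ =>
    fuzzy_chain_rule hT₁ hT₂ (hyΘ k) (hN' k) (ε := 1 / ((k : ℝ) + 1)) (by positivity)
  have hp' := ((WithLp.prod_continuous_ofLp 2 E G).tendsto _).comp hp
  have hq' := ((WithLp.prod_continuous_ofLp 2 E G).tendsto _).comp hq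
  have hmem : (0 : F) ∈ coderivative T₂ yb zb zs - inverse (coderivative T₁ xb yb) xs := by
    refine hCQ xs zs ⟨fun k => ((x k, y₁ k), (y₂ k, z k), (xs' k, zs' k)),
      fun k => ys₂ k - ys₁ k, ?_, squeeze_zero_norm hys tendsto_one_div_add_atTop_nhds_zero_nat,
      fun k => Set.sub_mem_sub (h₂ k) (h₁ k)⟩
    have hzs0 : Tendsto (fun k => -(q k).snd) atTop (𝓝 zs) := by
      simpa using hq'.snd_nhds.neg
    exact ((tendsto_of_norm_sub_le hp'.fst_nhds hx).prodMk_nhds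
      (tendsto_of_norm_sub_le hy hy₁)).prodMk_nhds
      (((tendsto_of_norm_sub_le hy hy₂).prodMk_nhds
        (tendsto_of_norm_sub_le hp'.snd_nhds hz)).prodMk_nhds
        ((tendsto_of_norm_sub_le hq'.fst_nhds hxs).prodMk_nhds
          (tendsto_of_norm_sub_le hzs0 hzs)))
  obtain ⟨ys, hys₂, ys', hys₁, hsub⟩ := hmem
  obtain rfl : ys = ys' := sub_eq_zero.1 hsub
  exact Set.mem_biUnion hys₂ hys₁

/-- Elements of the coderivative of a composition come with approximating regular normals. -/
theorem exists_seq_of_mem_coderivative_comp {Y : Type*} {T₁ : E → Set Y} {T₂ : Y → Set G}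
    {xb xs : E} {zb zs : G} (h : xs ∈ coderivative (comp T₂ T₁) xb zb zs) :
    ∃ p q : ℕ → WithLp 2 (E × G), Tendsto p atTop (𝓝 (WithLp.toLp 2 (xb, zb))) ∧
      Tendsto q atTop (𝓝 (WithLp.toLp 2 (xs, -zs))) ∧
      (∀ k, q k ∈ regularNormalCone (gph (comp T₂ T₁)) (p k)) ∧
      Tendsto (fun k => ((p k).fst, (p k).snd)) atTop (𝓝 (xb, zb)) ∧
      ∀ k, ((p k).fst, (p k).snd) ∈ dom (intermediate T₁ T₂) := by
  obtain ⟨-, p, q, hp, hq, hN⟩ := h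
  have hp := (tendsto_nhdsWithin_iff.1 hp).1
  refine ⟨p, q, hp, hq, hN, ((WithLp.prod_continuous_ofLp 2 E G).tendsto _).comp hp, fun k => ?_⟩
  obtain ⟨y, hy, hz⟩ := Set.mem_iUnion₂.1 (hN k).1
  exact ⟨y, hy, hz⟩

end Coderivative

end VarAnalysis

theorem mainTheorem12 {n m l : ℕ}
    (T₁ : EuclideanSpace ℝ (Fin n) → Set (EuclideanSpace ℝ (Fin m)))
    (T₂ : EuclideanSpace ℝ (Fin m) → Set (EuclideanSpace ℝ (Fin l)))
    (hT₁ : IsClosed (VarAnalysis.gph T₁)) (hT₂ : IsClosed (VarAnalysis.gph T₂))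
    (xb : EuclideanSpace ℝ (Fin n)) (zb : EuclideanSpace ℝ (Fin l))
    (hxz : zb ∈ VarAnalysis.comp T₂ T₁ xb) :
    (∀ yb ∈ VarAnalysis.intermediate T₁ T₂ (xb, zb),
      VarAnalysis.InnerSemicontinuousAt (VarAnalysis.intermediate T₁ T₂) (xb, zb) yb →
      VarAnalysis.ChainRuleCQ T₁ T₂ xb yb zb →
      ∀ zs : EuclideanSpace ℝ (Fin l),
        VarAnalysis.coderivative (VarAnalysis.comp T₂ T₁) xb zb zs ⊆
          ⋃ ys ∈ VarAnalysis.coderivative T₂ yb zb zs, VarAnalysis.coderivative T₁ xb yb ys) ∧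
    (VarAnalysis.InnerSemicompactAt (VarAnalysis.intermediate T₁ T₂) (xb, zb) →
      (∀ yb ∈ VarAnalysis.intermediate T₁ T₂ (xb, zb), VarAnalysis.ChainRuleCQ T₁ T₂ xb yb zb) →
      ∀ zs : EuclideanSpace ℝ (Fin l),
        VarAnalysis.coderivative (VarAnalysis.comp T₂ T₁) xb zb zs ⊆
          ⋃ yb ∈ VarAnalysis.intermediate T₁ T₂ (xb, zb),
            ⋃ ys ∈ VarAnalysis.coderivative T₂ yb zb zs,
              VarAnalysis.coderivative T₁ xb yb ys) := by
  refine ⟨fun yb _ hisc hCQ zs xs hxs => ?_, fun hisc hCQ zs xs hxs => ?_⟩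
  · obtain ⟨p, q, hp, hq, hN, hp', hdom⟩ := VarAnalysis.exists_seq_of_mem_coderivative_comp hxs
    obtain ⟨y, hy, hyΘ⟩ := hisc _ hp' hdom
    obtain ⟨N, hyN⟩ := eventually_atTop.1 hyΘ
    -- Shifting by `N` turns eventual membership into membership for every index.
    have hN' := tendsto_add_atTop_nat N
    exact VarAnalysis.mem_chain_of_tendsto hT₁ hT₂ hCQ (hp.comp hN') (hq.comp hN') (hy.comp hN')
      (fun k => hN _) (fun k => hyN _ (Nat.le_add_left _ _))
  · obtain ⟨p, q, hp, hq, hN, hp', hdom⟩ := VarAnalysis.exists_seq_of_mem_coderivative_comp hxs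
    obtain ⟨y, hbdd, hyΘ⟩ := hisc _ hp' hdom
    obtain ⟨N, hyN⟩ := eventually_atTop.1 hyΘ
    obtain ⟨yb, -, ψ, hψ, hy⟩ := tendsto_subseq_of_bounded hbdd
      (x := fun k => y (k + N)) (fun k => Set.mem_range_self _)
    have hφ : Tendsto (fun k => ψ k + N) atTop atTop :=
      (tendsto_add_atTop_nat N).comp hψ.tendsto_atTop
    have hyΘ' (k : ℕ) := hyN (ψ k + N) (Nat.le_add_left _ _)
    have hpφ := hp'.comp hφ
    -- Closedness of both graphs makes the cluster point an admissible intermediate point, so (Q)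
    -- applies there.
    have hyb : yb ∈ VarAnalysis.intermediate T₁ T₂ (xb, zb) :=
      ⟨(hT₁.preimage (WithLp.prod_continuous_toLp 2 _ _)).mem_of_tendsto
          (hpφ.fst_nhds.prodMk_nhds hy) (Eventually.of_forall fun k => (hyΘ' k).1),
        (hT₂.preimage (WithLp.prod_continuous_toLp 2 _ _)).mem_of_tendsto
          (hy.prodMk_nhds hpφ.snd_nhds) (Eventually.of_forall fun k => (hyΘ' k).2)⟩
    exact Set.mem_biUnion hyb (VarAnalysis.mem_chain_of_tendsto hT₁ hT₂ (hCQ yb hyb)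
      (hp.comp hφ) (hq.comp hφ) hy (fun k => hN _) hyΘ')
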